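/- A packing sequence is a non-decreasing infinite sequence $S=(s_1,s_2,s_3,\dots)$ of positive integers. For a graph $G$, an $S$-packing $k$-coloring is a map $\phi\colon V(G)\to\{1,\dots,k\}$ such that any two distinct vertices $u,v$ with $\phi(u)=\phi(v)=i$ satisfy $d_G(u,v)>s_i$ (with $d_G(u,v)=\infty$ if $u,v$ lie in different components). The $S$-packing chromatic number $\chi_S(G)$ is the least $k$ for which such a coloring exists, and $G$ is $\chi_S$-critical if $\chi_S(H)<\chi_S(G)$ for every proper subgraph $H$ of $G$. Let $C_n$ denote the cycle of order $n$. **Theorem.** Let $S$ be a packing sequence with $s_1=1$ and $s_2=2$, and let $n\ge 3$. (i) If $s_3=s_4=4$, then $C_n$ is $\chi_S$-critical if and only if $n\in\{3,5,6,7,9\}$. (ii) If $4\le s_3\le 5$ and $s_4=5$, then $C_n$ is $\chi_S$-critical if and only if $n\in\{3,5,6,7,9,10,11,17\}$. (iii) If $4\le s_3\le 6$ and $s_4=6$, then $C_n$ is $\chi_S$-critical if and only if $n\in\{3,5,6,7,9,10,11,12,13,17,18,19,20,25,26,27,33,34,41\}$. -/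

import Mathlib

/-- A packing sequence `s 1 ≤ s 2 ≤ s 3 ≤ ⋯` of positive integers, indexed from `1`;
the value `s 0` is irrelevant. -/
def IsPackingSequence (s : ℕ → ℕ) : Prop :=
  (∀ i, 1 ≤ i → 1 ≤ s i) ∧ ∀ i j, 1 ≤ i → i ≤ j → s i ≤ s j

namespace SimpleGraph

universe u

/-- `φ` is an `s`-packing `k`-coloring of `G`: it takes values in `{1, …, k}`, and two distinct
vertices of the same color `i` are at distance greater than `s i`
(vertices in different components are at distance `⊤`). -/
def IsPackingColoring {V : Type u} (G : SimpleGraph V) (s : ℕ → ℕ) (k : ℕ) (φ : V → ℕ) : Prop :=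
  (∀ v, φ v ∈ Finset.Icc 1 k) ∧
    ∀ u v, u ≠ v → φ u = φ v → (s (φ u) : ℕ∞) < G.edist u v

/-- The `S`-packing chromatic number: the least `k` for which `G` has an `s`-packing `k`-coloring
(and `⊤` if there is none, which cannot happen for finite graphs). -/
noncomputable def packingChromaticNumber {V : Type u} (G : SimpleGraph V) (s : ℕ → ℕ) : ℕ∞ :=
  ⨅ k ∈ {k : ℕ | ∃ φ : V → ℕ, G.IsPackingColoring s k φ}, (k : ℕ∞)

/-- `G` is `χ_S`-critical: every proper subgraph has a smaller `S`-packing chromatic number.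
Distances in a subgraph are measured in that subgraph. -/
def IsPackingCritical {V : Type u} (G : SimpleGraph V) (s : ℕ → ℕ) : Prop :=
  ∀ H : G.Subgraph, H ≠ ⊤ → H.coe.packingChromaticNumber s < G.packingChromaticNumber s

end SimpleGraph

/-! A proper subgraph of `C_n` misses an edge, so it embeds in the path obtained by cutting the
cycle there. Hence `C_n` is critical exactly when a word of length `n` needs fewer colors on the
path than around the cycle.

For `n ≥ 8` the path needs exactly four colors: eight consecutive letters cannot be taken from `{1,
2, 3}` (`no_three_letter_word`), while the periodic word `12131214…` always works. So criticality
means that `C_n` has no 4-coloring. In a 4-coloring, the occurrences of color 4 cut the cycle into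
blocks of length at least `s 4 + 1` by the distance condition and at most 8 by the word lemma.
Conversely, prefixes of `41213121` of such lengths can be concatenated cyclically. Thus a 4-coloring
exists iff `(s 4 + 1) * m ≤ n ≤ 8 * m` for some `m`, and arithmetic gives the three lists. The cases
`n < 8` are settled directly. -/

namespace SimpleGraph

-- Bounds on the packing chromatic number

universe u

section Basic

variable {V : Type u} {G : SimpleGraph V} {s : ℕ → ℕ}

lemma IsPackingColoring.mono {k l : ℕ} {φ : V → ℕ} (h : G.IsPackingColoring s k φ) (hkl : k ≤ l) :
    G.IsPackingColoring s l φ := by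
  refine ⟨fun v => ?_, h.2⟩
  have := h.1 v
  simp only [Finset.mem_Icc] at this ⊢
  omega

lemma IsPackingColoring.packingChromaticNumber_le {k : ℕ} {φ : V → ℕ}
    (h : G.IsPackingColoring s k φ) : G.packingChromaticNumber s ≤ k :=
  iInf₂_le k ⟨φ, h⟩

lemma lt_packingChromaticNumber {k : ℕ} (h : ∀ φ : V → ℕ, ¬ G.IsPackingColoring s k φ) :
    (k : ℕ∞) < G.packingChromaticNumber s := by
  have h1 : ((k + 1 : ℕ) : ℕ∞) ≤ G.packingChromaticNumber s := by
    refine le_iInf₂ ?_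
    rintro j ⟨φ, hφ⟩
    by_contra hlt
    have hj : j ≤ k := by
      rw [not_le, Nat.cast_lt] at hlt
      omega
    exact h φ (hφ.mono hj)
  exact lt_of_lt_of_le (by exact_mod_cast Nat.lt_succ_self k) h1

lemma exists_walk_of_edist_le {u v : V} {t : ℕ} (h : G.edist u v ≤ t) :
    ∃ p : G.Walk u v, p.length ≤ t := by
  have hne : G.edist u v ≠ ⊤ := fun h' => by simp [h'] at h
  obtain ⟨p, hp⟩ := exists_walk_of_edist_ne_top hne
  exact ⟨p, by rw [← hp] at h; exact_mod_cast h⟩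

end Basic

/-! ### Words in which equal letters `c` are more than `s c` apart -/

/-- No two 1s are adjacent, and two 2s can only sit at the ends of the window, which forces `11` in
the middle. -/
lemma no_two_letter_word {s ψ : ℕ → ℕ} (h1 : s 1 = 1) (h2 : s 2 = 2) (b : ℕ)
    (hψ : ∀ i < 4, ψ (b + i) = 1 ∨ ψ (b + i) = 2)
    (hd : ∀ i d, b ≤ i → i + d < b + 4 → 0 < d → ψ i = ψ (i + d) → s (ψ i) < d) : False := by
  have a0 := hψ 0 (by omega)
  have a1 := hψ 1 (by omega)
  have a2 := hψ 2 (by omega)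
  have a3 := hψ 3 (by omega)
  have d01 := hd (b + 0) 1 (by omega) (by omega) (by omega)
  have d12 := hd (b + 1) 1 (by omega) (by omega) (by omega)
  have d23 := hd (b + 2) 1 (by omega) (by omega) (by omega)
  have d02 := hd (b + 0) 2 (by omega) (by omega) (by omega)
  have d13 := hd (b + 1) 2 (by omega) (by omega) (by omega)
  simp only [add_assoc, Nat.reduceAdd, add_zero] at *
  rcases a0 with a0 | a0 <;> rcases a1 with a1 | a1 <;> rcases a2 with a2 | a2 <;>
    rcases a3 with a3 | a3 <;> simp [a0, a1, a2, a3, h1, h2] at d01 d12 d23 d02 d13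

/-- Some 3 occurs among the first four letters; as `s 3 ≥ 4`, the four letters after it use only 1
and 2. Only differences up to 4 matter, so the lemma also applies to windows wrapped around a cycle
with `n ≥ 5`. -/
lemma no_three_letter_word {s ψ : ℕ → ℕ} (h1 : s 1 = 1) (h2 : s 2 = 2) (h3 : 4 ≤ s 3) (b : ℕ)
    (hψ : ∀ i < 8, ψ (b + i) ∈ Finset.Icc 1 3)
    (hd : ∀ i d, b ≤ i → i + d < b + 8 → 0 < d → d ≤ 4 → ψ i = ψ (i + d) → s (ψ i) < d) :
    False := by
  have key : ∃ i < 4, ψ (b + i) = 3 := by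
    by_contra! hne
    refine no_two_letter_word h1 h2 b (fun i hi => ?_) (fun i d _ _ _ => hd i d ‹_› (by omega)
      ‹_› (by omega))
    have := hψ i (by omega)
    have := hne i hi
    simp only [Finset.mem_Icc] at *
    omega
  obtain ⟨i, hi, hi3⟩ := key
  refine no_two_letter_word h1 h2 (b + i + 1) (fun j hj => ?_) (fun i d _ _ _ => hd i d
    (by omega) (by omega) ‹_› (by omega))
  have h := hψ (i + 1 + j) (by omega)
  have h' := hd (b + i) (1 + j) (by omega) (by omega) (by omega) (by omega)
  simp only [← add_assoc, Finset.mem_Icc] at h h'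
  rw [hi3] at h'
  by_contra hcon
  have := h' (by omega)
  omega

/-! ### Colorings of cycles and paths as words -/

lemma exists_shift_of_cycleGraph_walk {n : ℕ} {u v : Fin n}
    (p : (cycleGraph n).Walk u v) :
    ∃ d ≤ p.length, (u.val + d) % n = v.val ∨ (v.val + d) % n = u.val := by
  -- Signed displacement along the walk: each step adds `1` or `-1` modulo `n`.
  have key : ∃ d : ℤ, |d| ≤ p.length ∧ (n : ℤ) ∣ u.val + d - v.val := by
    induction p with
    | nil => exact ⟨0, by simp⟩
    | @cons a b c hab q ih =>
      obtain ⟨d, hd, hdvd⟩ := ih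
      rw [cycleGraph_adj'] at hab
      have hval : ∀ x y : Fin n, (x - y).val = 1 → (n : ℤ) ∣ x.val - y.val - 1 := by
        intro x y hxy
        rw [Fin.sub_def] at hxy
        have h1 := Nat.div_add_mod (n - y.val + x.val) n
        simp only at hxy
        rw [hxy] at h1
        have hy := y.isLt
        zify [hy.le] at h1
        exact ⟨((n - y.val + x.val) / n : ℕ) - 1, by
          push_cast [Nat.cast_sub hy.le]
          linarith⟩
      rw [Walk.length_cons]
      push_cast
      rcases hab with h | h
      · refine ⟨d - 1, ?_, ?_⟩
        · rw [abs_le] at *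
          constructor <;> omega
        · have := dvd_add hdvd (hval _ _ h)
          rwa [show (b.val + d - c.val + (a.val - b.val - 1) : ℤ) = a.val + (d - 1) - c.val by
            ring] at this
      · refine ⟨d + 1, ?_, ?_⟩
        · rw [abs_le] at *
          constructor <;> omega
        · have := dvd_sub hdvd (hval _ _ h)
          rwa [show (b.val + d - c.val - (b.val - a.val - 1) : ℤ) = a.val + (d + 1) - c.val by
            ring] at this
  obtain ⟨d, hd, hdvd⟩ := key
  refine ⟨d.natAbs, by rw [Int.abs_eq_natAbs] at hd; omega, ?_⟩
  rcases le_total 0 d with h0 | h0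
  · left
    rw [← Nat.mod_eq_of_lt v.isLt]
    refine ((Nat.modEq_iff_dvd).2 ?_).symm
    push_cast
    rwa [abs_of_nonneg h0]
  · right
    rw [← Nat.mod_eq_of_lt u.isLt]
    refine (Nat.modEq_iff_dvd).2 ?_
    push_cast
    rw [abs_of_nonpos h0]
    convert hdvd using 1
    ring

lemma isPackingColoring_cycleGraph {s ψ : ℕ → ℕ} {n k : ℕ} (hn : 2 ≤ n)
    (hk : ∀ i, ψ i ∈ Finset.Icc 1 k) (hper : ∀ i, ψ (i % n) = ψ i)
    (hd : ∀ i d, 0 < d → d < n → ψ i = ψ (i + d) → s (ψ i) < d) :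
    (cycleGraph n).IsPackingColoring s k (fun v => ψ v.val) := by
  refine ⟨fun v => hk _, fun u v huv he => ?_⟩
  by_contra hlt
  obtain ⟨p, hp⟩ := exists_walk_of_edist_le (not_lt.1 hlt)
  obtain ⟨d, hdp, h⟩ := exists_shift_of_cycleGraph_walk p
  -- The walk may wind around the cycle, so its displacement is reduced modulo `n` before `hd`
  -- applies.
  have hmod : d % n ≤ d := Nat.mod_le d n
  have aux : ∀ x y : Fin n, x ≠ y → ψ x.val = ψ y.val → (x.val + d) % n = y.val →
      s (ψ x.val) < d := by
    intro x y hxy hc hs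
    have hs' : (x.val + d % n) % n = y.val := by rw [Nat.add_mod_mod, hs]
    refine lt_of_lt_of_le (hd x.val (d % n) ?_ (Nat.mod_lt _ (by omega)) ?_) hmod
    · rcases Nat.eq_zero_or_pos (d % n) with h0 | h0
      · rw [h0, add_zero, Nat.mod_eq_of_lt x.isLt] at hs'
        exact absurd (Fin.ext hs') hxy
      · exact h0
    · rw [hc, ← hper (x.val + d % n), hs']
  rcases h with h | h
  · have := aux u v huv he h
    simp only at hp
    omega
  · have := aux v u huv.symm he.symm h
    simp only at he hp
    rw [← he] at this
    omega

lemma edist_cycleGraph_le {n : ℕ} (hn : 2 ≤ n) (i d : ℕ) :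
    (cycleGraph n).edist ⟨i % n, Nat.mod_lt _ (by omega)⟩ ⟨(i + d) % n, Nat.mod_lt _ (by omega)⟩
      ≤ d := by
  induction d with
  | zero => simp
  | succ d ih =>
    have hadj : (cycleGraph n).Adj ⟨(i + d) % n, Nat.mod_lt _ (by omega)⟩
        ⟨(i + (d + 1)) % n, Nat.mod_lt _ (by omega)⟩ := by
      rw [cycleGraph_adj']
      right
      rw [Fin.sub_def]
      simp only
      have h1 := Nat.mod_lt (i + d) (show 0 < n by omega)
      rw [← add_assoc, ← Nat.mod_add_mod (i + d) n 1, Nat.add_mod_mod,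
        show n - (i + d) % n + ((i + d) % n + 1) = 1 + n by omega, Nat.add_mod_right,
        Nat.mod_eq_of_lt (by omega)]
    calc _ ≤ _ := SimpleGraph.edist_triangle
      _ ≤ (d : ℕ∞) + 1 := add_le_add ih (edist_eq_one_iff_adj.2 hadj).le
      _ = _ := by push_cast; rfl

lemma IsPackingColoring.cycleGraph_word {s : ℕ → ℕ} {n k : ℕ} (hn : 2 ≤ n) {φ : Fin n → ℕ}
    (h : (cycleGraph n).IsPackingColoring s k φ) :
    ∃ ψ : ℕ → ℕ, (∀ i, ψ i ∈ Finset.Icc 1 k) ∧ (∀ i, ψ (i + n) = ψ i) ∧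
      ∀ i d, 0 < d → d < n → ψ i = ψ (i + d) → s (ψ i) < d := by
  refine ⟨fun i => φ ⟨i % n, Nat.mod_lt _ (by omega)⟩, fun i => h.1 _, fun i => by simp,
    fun i d h0 hdn he => ?_⟩
  have hne : (⟨i % n, Nat.mod_lt _ (by omega)⟩ : Fin n) ≠
      ⟨(i + d) % n, Nat.mod_lt _ (by omega)⟩ := by
    intro heq
    have h1 : i + 0 ≡ i + d [MOD n] := Fin.mk.inj heq
    have h2 : 0 % n = d % n := Nat.ModEq.add_left_cancel' i h1
    rw [Nat.mod_eq_of_lt hdn, Nat.zero_mod] at h2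
    omega
  exact_mod_cast lt_of_lt_of_le (h.2 _ _ hne he) (edist_cycleGraph_le hn i d)

/-- Colorings of a proper subgraph of a cycle from words of length `n`. -/
lemma exists_isPackingColoring_of_ne_top {s g : ℕ → ℕ} {n k : ℕ} (hn : 3 ≤ n)
    (hk : ∀ i < n, g i ∈ Finset.Icc 1 k)
    (hd : ∀ i d, 0 < d → i + d < n → g i = g (i + d) → s (g i) < d)
    (H : (cycleGraph n).Subgraph) (hH : H ≠ ⊤) :
    ∃ φ, H.coe.IsPackingColoring s k φ := by
  have hval : ∀ x y : Fin n, (x - y).val = 1 → x.val = (y.val + 1) % n := by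
    intro x y hxy
    have : NeZero n := ⟨by omega⟩
    have h1 : x - y = 1 := by
      apply Fin.ext
      rw [hxy, Fin.val_one', Nat.mod_eq_of_lt (by omega)]
    have h2 : x = y + 1 := by rw [← h1]; abel
    rw [h2, Fin.val_add, Fin.val_one', Nat.mod_eq_of_lt (show 1 < n by omega)]
  -- A subgraph containing every edge of the cycle contains every vertex, so a proper one misses an
  -- edge.
  have hcut : ∃ a b : Fin n, b.val = (a.val + 1) % n ∧ ¬ H.Adj a b := by
    by_contra! hall
    have hsucc : ∀ a : Fin n, H.Adj a ⟨(a.val + 1) % n, Nat.mod_lt _ (by omega)⟩ :=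
      fun a => hall a _ rfl
    apply hH
    rw [eq_top_iff]
    refine ⟨fun a _ => (hsucc a).fst_mem, fun a b hab => ?_⟩
    rw [Subgraph.top_adj, cycleGraph_adj'] at hab
    rcases hab with h | h
    · exact (hall b a (hval _ _ h)).symm
    · exact hall a b (hval _ _ h)
  obtain ⟨a, b, hb, hab⟩ := hcut
  -- Coordinate along the cut cycle: it starts with `0` at `b` and ends with `n - 1` at `a`.
  let x : Fin n → ℕ := fun v => (v.val + (n - b.val)) % n
  have hxlt : ∀ v, x v < n := fun v => Nat.mod_lt _ (by omega)
  have hxv : ∀ v, (b.val ≤ v.val ∧ x v = v.val - b.val) ∨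
      (v.val < b.val ∧ x v = v.val + n - b.val) := by
    intro v
    have := v.isLt
    have := b.isLt
    rcases le_or_gt b.val v.val with h | h
    · refine Or.inl ⟨h, ?_⟩
      simp only [x]
      rw [show v.val + (n - b.val) = v.val - b.val + n by omega, Nat.add_mod_right,
        Nat.mod_eq_of_lt (by omega)]
    · refine Or.inr ⟨h, ?_⟩
      simp only [x]
      rw [Nat.mod_eq_of_lt (by omega)]
      omega
  have hxinj : ∀ u v, x u = x v → u = v := by
    intro u v huv
    have := u.isLt
    have := v.isLt
    have := b.isLt
    have := hxv u
    have := hxv v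
    apply Fin.ext
    omega
  have hstep : ∀ u v : Fin n, v.val = (u.val + 1) % n → (u, v) ≠ (a, b) → x v = x u + 1 := by
    intro u v huv hne
    have h1 := hxv u
    have h2 := hxv v
    have hu := u.isLt
    have hv := v.isLt
    have ha := a.isLt
    have hbb := b.isLt
    have hcase : ∀ w : Fin n, (w.val + 1 < n ∧ (w.val + 1) % n = w.val + 1) ∨
        (w.val + 1 = n ∧ (w.val + 1) % n = 0) := by
      intro w
      rcases lt_or_ge (w.val + 1) n with h | h
      · exact Or.inl ⟨h, Nat.mod_eq_of_lt h⟩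
      · have hw : w.val + 1 = n := by have := w.isLt; omega
        exact Or.inr ⟨hw, by rw [hw, Nat.mod_self]⟩
    have c1 := hcase u
    have c2 := hcase a
    have hvb : v.val ≠ b.val := by
      intro h
      apply hne
      rw [Prod.mk.injEq]
      exact ⟨Fin.ext (by omega), Fin.ext h⟩
    omega
  have hadj : ∀ u v : Fin n, H.Adj u v → x v = x u + 1 ∨ x u = x v + 1 := by
    intro u v huv
    have h := huv.adj_sub
    rw [cycleGraph_adj'] at h
    rcases h with h | h
    · right
      refine hstep v u (hval _ _ h) ?_
      rintro ⟨⟩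
      exact hab huv.symm
    · left
      refine hstep u v (hval _ _ h) ?_
      rintro ⟨⟩
      exact hab huv
  -- The missing edge is the only place where `x` could jump, so distances in `H` dominate
  -- differences of `x`.
  have hwalk : ∀ u v : H.verts, ∀ p : H.coe.Walk u v,
      x u ≤ x v + p.length ∧ x v ≤ x u + p.length := by
    intro u v p
    induction p with
    | nil => simp
    | cons h q ih =>
      have := hadj _ _ h
      rw [Walk.length_cons]
      omega
  refine ⟨fun v => g (x v), fun v => hk _ (hxlt _), fun u v huv he => ?_⟩
  by_contra hlt
  obtain ⟨p, hp⟩ := exists_walk_of_edist_le (not_lt.1 hlt)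
  have hw := hwalk u v p
  have hne : x u ≠ x v := fun h => huv (Subtype.ext (hxinj _ _ h))
  have aux : ∀ i j, i < j → j < n → g i = g j → s (g i) < j - i := by
    intro i j hij hj hg
    exact hd i (j - i) (by omega) (by omega) (by rwa [show i + (j - i) = j by omega])
  simp only at he hp
  rcases lt_or_gt_of_ne hne with h | h
  · have := aux _ _ h (hxlt _) he
    omega
  · have := aux _ _ h (hxlt _) he.symm
    rw [← he] at this
    omega

/-- A cycle with an edge removed; its colorings are words of length `n`. -/
lemma exists_ne_top_word {n : ℕ} (hn : 3 ≤ n) :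
    ∃ H : (cycleGraph n).Subgraph, H ≠ ⊤ ∧ ∀ (s : ℕ → ℕ) (k : ℕ) (φ : H.verts → ℕ),
      H.coe.IsPackingColoring s k φ → ∃ ψ : ℕ → ℕ, (∀ i < n, ψ i ∈ Finset.Icc 1 k) ∧
        ∀ i d, 0 < d → i + d < n → ψ i = ψ (i + d) → s (ψ i) < d := by
  have hle : pathGraph n ≤ cycleGraph n := pathGraph_le_cycleGraph
  refine ⟨toSubgraph (pathGraph n) hle, ?_, ?_⟩
  · intro h
    have h1 : (toSubgraph (pathGraph n) hle).Adj ⟨0, by omega⟩ ⟨n - 1, by omega⟩ := by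
      rw [h, Subgraph.top_adj, cycleGraph_adj', Fin.sub_def]
      left
      simp only [add_zero]
      rw [Nat.mod_eq_of_lt (by omega)]
      omega
    have h2 : (pathGraph n).Adj ⟨0, by omega⟩ ⟨n - 1, by omega⟩ := h1
    rw [pathGraph_adj] at h2
    simp only at h2
    omega
  · intro s k φ hφ
    let e : ℕ → (toSubgraph (pathGraph n) hle).verts := fun i =>
      ⟨⟨i % n, Nat.mod_lt _ (by omega)⟩, trivial⟩
    have hdist : ∀ i d, i + d < n →
        (toSubgraph (pathGraph n) hle).coe.edist (e i) (e (i + d)) ≤ d := by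
      intro i d
      induction d with
      | zero => simp
      | succ d ih =>
        intro hid
        have hadj : (toSubgraph (pathGraph n) hle).coe.Adj (e (i + d)) (e (i + (d + 1))) := by
          change (pathGraph n).Adj ⟨(i + d) % n, _⟩ ⟨(i + (d + 1)) % n, _⟩
          rw [pathGraph_adj]
          left
          simp only
          rw [Nat.mod_eq_of_lt (by omega), Nat.mod_eq_of_lt (by omega)]
          omega
        calc _ ≤ _ := SimpleGraph.edist_triangle
          _ ≤ (d : ℕ∞) + 1 := add_le_add (ih (by omega)) (edist_eq_one_iff_adj.2 hadj).le
          _ = _ := by push_cast; rfl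
    refine ⟨fun i => φ (e i), fun i _ => hφ.1 _, fun i d h0 hdn he => ?_⟩
    have hne : e i ≠ e (i + d) := by
      intro heq
      have h1 : i % n = (i + d) % n := congrArg (fun v => v.1.val) heq
      rw [Nat.mod_eq_of_lt (by omega), Nat.mod_eq_of_lt (by omega)] at h1
      omega
    exact_mod_cast lt_of_lt_of_le (hφ.2 _ _ hne he) (hdist i d hdn)

lemma isPackingCritical_cycleGraph_of_word {s g : ℕ → ℕ} {n k : ℕ} (hn : 3 ≤ n)
    (hk : ∀ i < n, g i ∈ Finset.Icc 1 k)
    (hd : ∀ i d, 0 < d → i + d < n → g i = g (i + d) → s (g i) < d)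
    (hno : ∀ φ, ¬ (cycleGraph n).IsPackingColoring s k φ) :
    (cycleGraph n).IsPackingCritical s := by
  intro H hH
  obtain ⟨φ, hφ⟩ := exists_isPackingColoring_of_ne_top hn hk hd H hH
  exact lt_of_le_of_lt hφ.packingChromaticNumber_le (lt_packingChromaticNumber hno)

lemma not_isPackingCritical_cycleGraph {s : ℕ → ℕ} {n k : ℕ} (hn : 3 ≤ n) {φ : Fin n → ℕ}
    (hφ : (cycleGraph n).IsPackingColoring s (k + 1) φ)
    (hno : ∀ ψ : ℕ → ℕ, (∀ i < n, ψ i ∈ Finset.Icc 1 k) →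
      ¬ ∀ i d, 0 < d → i + d < n → ψ i = ψ (i + d) → s (ψ i) < d) :
    ¬ (cycleGraph n).IsPackingCritical s := by
  intro hc
  obtain ⟨H, hH, hw⟩ := exists_ne_top_word hn
  have h1 : (k : ℕ∞) < H.coe.packingChromaticNumber s := by
    refine lt_packingChromaticNumber fun χ hχ => ?_
    obtain ⟨ψ, hψ, hψd⟩ := hw s k χ hχ
    exact hno ψ hψ hψd
  have h2 := lt_of_lt_of_le (hc H hH) hφ.packingChromaticNumber_le
  have h3 : H.coe.packingChromaticNumber s ≤ k := by
    push_cast at h2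
    exact Order.le_of_lt_add_one h2
  exact absurd h1 (not_lt.2 h3)

/-! ### Four colors on a cycle -/

/-- Induction from one 4 to the next: each gap lies between `s 4 + 1` and 8, and `m` counts the
gaps. Taking `N = n` closes the cycle. -/
lemma exists_block_count {s ψ : ℕ → ℕ} {n : ℕ} (h1 : s 1 = 1) (h2 : s 2 = 2) (h3 : 4 ≤ s 3)
    (hn : s 4 < n) (hn5 : 5 ≤ n) (hψ : ∀ i, ψ i ∈ Finset.Icc 1 4)
    (hd : ∀ i d, 0 < d → d < n → ψ i = ψ (i + d) → s (ψ i) < d) (N : ℕ) :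
    ∀ i, ψ i = 4 → ψ (i + N) = 4 → ∃ m, (s 4 + 1) * m ≤ N ∧ N ≤ 8 * m := by
  have hgap : ∀ i d, 0 < d → ψ i = 4 → ψ (i + d) = 4 → s 4 < d := by
    intro i d h0 hi hid
    -- For `d ≥ n` the distance condition says nothing, but then `d ≥ n > s 4`.
    rcases lt_or_ge d n with h | h
    · have := hd i d h0 h (by rw [hi, hid])
      rwa [hi] at this
    · omega
  induction N using Nat.strong_induction_on with
  | _ N ih =>
    intro i hi hiN
    rcases Nat.eq_zero_or_pos N with rfl | h0
    · exact ⟨0, by simp⟩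
    rcases le_or_gt N 8 with h8 | h8
    · exact ⟨1, by have := hgap i N h0 hi hiN; omega, by omega⟩
    have hnext : ∃ j < 8, ψ (i + 1 + j) = 4 := by
      by_contra! hne
      refine no_three_letter_word h1 h2 h3 (i + 1) (fun j hj => ?_)
        (fun i d _ _ h0 h4 => hd i d h0 (by omega))
      have := hψ (i + 1 + j)
      have := hne j hj
      simp only [Finset.mem_Icc] at *
      omega
    obtain ⟨j, hj, hj4⟩ := hnext
    obtain ⟨m, hm1, hm2⟩ := ih (N - (1 + j)) (by omega) (i + 1 + j) hj4
      (by rwa [show i + 1 + j + (N - (1 + j)) = i + N by omega])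
    have := hgap i (1 + j) (by omega) hi (by rwa [← add_assoc])
    refine ⟨m + 1, ?_, by omega⟩
    rw [mul_add]
    omega

lemma not_isPackingColoring_three {s : ℕ → ℕ} {n : ℕ} (h1 : s 1 = 1) (h2 : s 2 = 2)
    (h3 : 4 ≤ s 3) (hn : 5 ≤ n) (φ : Fin n → ℕ) :
    ¬ (cycleGraph n).IsPackingColoring s 3 φ := by
  intro h
  obtain ⟨ψ, hψ, -, hd⟩ := h.cycleGraph_word (by omega)
  exact no_three_letter_word h1 h2 h3 0 (fun i _ => hψ _)
    (fun i d _ _ h0 h4 => hd i d h0 (by omega))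

lemma IsPackingColoring.exists_block_count {s : ℕ → ℕ} {n : ℕ} (h1 : s 1 = 1) (h2 : s 2 = 2)
    (h3 : 4 ≤ s 3) (hn : s 4 < n) (hn5 : 5 ≤ n) {φ : Fin n → ℕ}
    (h : (cycleGraph n).IsPackingColoring s 4 φ) :
    ∃ m, (s 4 + 1) * m ≤ n ∧ n ≤ 8 * m := by
  obtain ⟨ψ, hψ, hper, hd⟩ := h.cycleGraph_word (by omega)
  have h4 : ∃ i, ψ i = 4 := by
    by_contra! hne
    refine no_three_letter_word h1 h2 h3 0 (fun j hj => ?_)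
      (fun i d _ _ h0 h4 => hd i d h0 (by omega))
    have := hψ (0 + j)
    have := hne (0 + j)
    simp only [Finset.mem_Icc] at *
    omega
  obtain ⟨i, hi⟩ := h4
  exact SimpleGraph.exists_block_count h1 h2 h3 hn hn5 hψ hd n i hi (by rw [hper, hi])

/-- Positions inside consecutive blocks whose lengths lie between `a` and `8`. -/
lemma exists_block_positions {a : ℕ} (ha : 1 ≤ a) (ha8 : a ≤ 8) (m : ℕ) :
    ∀ N, a * m ≤ N → N ≤ 8 * m → ∃ p : ℕ → ℕ, p 0 = 0 ∧ p N = 0 ∧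
      ∀ v < N, (p (v + 1) = p v + 1 ∧ p v + 1 ≤ 7) ∨ (p (v + 1) = 0 ∧ a ≤ p v + 1 ∧ p v ≤ 7) := by
  induction m with
  | zero =>
    intro N _ h
    obtain rfl : N = 0 := by omega
    exact ⟨fun _ => 0, rfl, rfl, fun v hv => by omega⟩
  | succ m ih =>
    intro N h1 h2
    rw [mul_add, mul_one] at h1
    -- The length of the last block: 8, unless this leaves less than `a * m` for the others, in
    -- which case they all get length `a`.
    obtain ⟨L, hL1, hL2, hLN, hl, hu⟩ : ∃ L, a ≤ L ∧ L ≤ 8 ∧ L ≤ N ∧ a * m ≤ N - L ∧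
        N - L ≤ 8 * m := by
      rcases le_or_gt (N - a * m) 8 with h | h
      · have : a * m ≤ 8 * m := Nat.mul_le_mul_right _ ha8
        exact ⟨N - a * m, by omega, h, by omega, by omega, by omega⟩
      · exact ⟨8, ha8, le_rfl, by omega, by omega, by omega⟩
    obtain ⟨p, hp0, hpN, hp⟩ := ih (N - L) hl hu
    refine ⟨fun v => if v ≤ N - L then p v else if v = N then 0 else v - (N - L), ?_, ?_, ?_⟩
    · simp [hp0]
    · simp only [if_true]
      rw [if_neg (by omega)]
    · intro v hv
      rcases lt_trichotomy v (N - L) with h | h | h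
      · have := hp v h
        simp only
        rwa [if_pos (by omega), if_pos (by omega)]
      · simp only
        rw [if_neg (by omega), if_pos (show v ≤ N - L by omega), h, hpN]
        split_ifs <;> omega
      · simp only
        rw [if_neg (by omega), if_neg (show ¬ v ≤ N - L by omega), if_neg (show ¬ v = N by omega)]
        split_ifs <;> omega

/-- The letters of the word `41213121`. -/
def blockLetter (x : ℕ) : ℕ :=
  if x % 2 = 1 then 1 else if x = 0 then 4 else if x = 4 then 3 else 2

lemma exists_isPackingColoring_four {s : ℕ → ℕ} {n m : ℕ} (h1 : s 1 = 1) (h2 : s 2 = 2)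
    (h34 : s 3 ≤ s 4) (h4 : 4 ≤ s 4) (h4' : s 4 ≤ 7) (hn : 2 ≤ n)
    (hm : (s 4 + 1) * m ≤ n) (hm' : n ≤ 8 * m) :
    ∃ φ, (cycleGraph n).IsPackingColoring s 4 φ := by
  obtain ⟨p, hp0, hpn, hp⟩ := exists_block_positions (a := s 4 + 1) (by omega) (by omega) m n hm hm'
  -- Position of `v` inside its block, extended periodically.
  let P : ℕ → ℕ := fun v => p (v % n)
  have hP : ∀ v, (P (v + 1) = P v + 1 ∧ P v + 1 ≤ 7) ∨
      (P (v + 1) = 0 ∧ s 4 + 1 ≤ P v + 1 ∧ P v ≤ 7) := by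
    intro v
    have hlt : v % n < n := Nat.mod_lt _ (by omega)
    have h := hp _ hlt
    have hmod : p ((v + 1) % n) = p (v % n + 1) := by
      rw [← Nat.mod_add_mod]
      rcases lt_or_ge (v % n + 1) n with h' | h'
      · rw [Nat.mod_eq_of_lt h']
      · rw [show v % n + 1 = n by omega, Nat.mod_self, hp0, hpn]
    simp only [P, hmod]
    exact h
  have hP7 : ∀ v, P v ≤ 7 := fun v => by have := hP v; omega
  -- Within `s 4` steps at most one block boundary is crossed; when one is, `P v + d - P (v + d)` is
  -- the length of the block left behind.
  have hshift : ∀ v d, d ≤ s 4 → P (v + d) = P v + d ∨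
      (P (v + d) < d ∧ s 4 + 1 + P (v + d) ≤ P v + d) := by
    intro v d
    induction d with
    | zero => simp
    | succ d ih =>
      intro hd
      have h := ih (by omega)
      have h' := hP (v + d)
      rw [← add_assoc]
      omega
  refine ⟨_, isPackingColoring_cycleGraph (ψ := fun v => blockLetter (P v)) hn ?_ ?_ ?_⟩
  · intro i
    simp only [blockLetter, Finset.mem_Icc]
    split_ifs <;> omega
  · intro i
    simp only [P, Nat.mod_mod]
  · intro i d h0 _ he
    by_contra hlt
    have hi := hP7 i
    have hid := hP7 (i + d)
    have hs : s (blockLetter (P i)) ≤ s 4 := by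
      simp only [blockLetter]
      split_ifs <;> omega
    have h := hshift i d (by omega)
    generalize P i = x at *
    generalize P (i + d) = y at *
    -- For each letter, `h` excludes a repetition too close: 3 and 4 occupy one fixed position each,
    -- while 1 and 2 use the block structure and `s 1 = 1`, `s 2 = 2`.
    by_cases hx1 : x % 2 = 1
    · have : blockLetter x = 1 := by simp [blockLetter, hx1]
      rw [this, h1] at hlt
      have hy : y % 2 = 1 := by
        by_contra hy
        rw [this] at he
        simp only [blockLetter, if_neg hy] at he
        split_ifs at he <;> omega
      omega
    · by_cases hx0 : x = 0
      · subst hx0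
        have hy : y = 0 := by
          by_contra hy
          simp only [blockLetter, if_neg hy] at he
          split_ifs at he <;> omega
        omega
      · by_cases hx4 : x = 4
        · subst hx4
          have hy : y = 4 := by
            by_contra hy
            simp only [blockLetter, if_neg hy] at he
            split_ifs at he <;> omega
          omega
        · have : blockLetter x = 2 := by simp [blockLetter, hx1, hx0, hx4]
          rw [this, h2] at hlt
          rw [this] at he
          have hy : y % 2 = 0 ∧ y ≠ 0 ∧ y ≠ 4 := by
            simp only [blockLetter] at he
            split_ifs at he <;> omega
          omega

/-! ### Criticality of cycles -/

/-- The letters of the word `12131214`, repeated periodically. -/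
def pathLetter (x : ℕ) : ℕ :=
  if x % 2 = 0 then 1 else if x % 4 = 1 then 2 else if x % 8 = 3 then 3 else 4

lemma pathLetter_spacing {s : ℕ → ℕ} (h1 : s 1 = 1) (h2 : s 2 = 2) (h3 : s 3 ≤ 7) (h4 : s 4 ≤ 7)
    (i d : ℕ) (h0 : 0 < d) (he : pathLetter i = pathLetter (i + d)) : s (pathLetter i) < d := by
  simp only [pathLetter] at *
  split_ifs at * <;> omega

/-- The path words `121` and `1213121` use two and three colors, while the corresponding cycles need
one more. -/
lemma isPackingCritical_cycleGraph_of_small {s : ℕ → ℕ} {n : ℕ} (h1 : s 1 = 1) (h2 : s 2 = 2)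
    (h3 : 4 ≤ s 3) (h3' : s 3 ≤ 7) (h4' : s 4 ≤ 7) (hn : n ∈ ({3, 5, 6, 7} : Set ℕ)) :
    (cycleGraph n).IsPackingCritical s := by
  simp only [Set.mem_insert_iff, Set.mem_singleton_iff] at hn
  by_cases hn3 : n = 3
  · refine isPackingCritical_cycleGraph_of_word (g := pathLetter) (k := 2) (by omega)
      (fun i hi => ?_) (fun i d h0 _ => pathLetter_spacing h1 h2 h3' h4' i d h0) (fun φ hφ => ?_)
    · simp only [pathLetter, Finset.mem_Icc]
      split_ifs <;> omega
    · obtain ⟨ψ, hψ, -, hd⟩ := hφ.cycleGraph_word (by omega)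
      refine no_two_letter_word (ψ := ψ) h1 h2 0 (fun i _ => ?_) (fun i d _ hlt h0 he => ?_)
      -- The four-letter window wraps around the triangle; repetitions at distance `d ≥ 3` are
      -- harmless because both letters have `s ≤ 2`.
      · have := hψ (0 + i)
        simp only [Finset.mem_Icc] at this
        omega
      · rcases lt_or_ge d n with h | h
        · exact hd i d h0 h he
        · have := hψ i
          simp only [Finset.mem_Icc] at this
          rcases (by omega : ψ i = 1 ∨ ψ i = 2) with h' | h' <;> rw [h'] <;> omega
  · refine isPackingCritical_cycleGraph_of_word (g := pathLetter) (k := 3) (by omega)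
      (fun i hi => ?_) (fun i d h0 _ => pathLetter_spacing h1 h2 h3' h4' i d h0)
      (not_isPackingColoring_three h1 h2 h3 (by omega))
    simp only [pathLetter, Finset.mem_Icc]
    split_ifs <;> omega

/-- The word `1213` colors the cycle with three colors, and already the path on four vertices needs
three. -/
lemma not_isPackingCritical_cycleGraph_four {s : ℕ → ℕ} (h1 : s 1 = 1) (h2 : s 2 = 2) :
    ¬ (cycleGraph 4).IsPackingCritical s := by
  refine not_isPackingCritical_cycleGraph (k := 2) (by omega)
    (isPackingColoring_cycleGraph (ψ := fun i => pathLetter (i % 4)) (by omega) ?_ ?_ ?_) ?_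
  · intro i
    simp only [pathLetter, Finset.mem_Icc]
    split_ifs <;> omega
  · intro i
    simp
  · intro i d h0 h4 he
    simp only [pathLetter] at *
    split_ifs at * <;> omega
  · intro ψ hψ hd
    refine no_two_letter_word h1 h2 0 (fun i hi => ?_) (fun i d _ hlt h0 => hd i d h0 (by omega))
    have := hψ (0 + i) (by omega)
    simp only [Finset.mem_Icc] at this
    omega

/-- For `n ≥ 8`, the cycle `C_n` is critical iff `n` is not a sum of numbers between `s 4 + 1`
and `8`. -/
lemma isPackingCritical_cycleGraph_iff {s : ℕ → ℕ} {n : ℕ} (h1 : s 1 = 1) (h2 : s 2 = 2)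
    (h3 : 4 ≤ s 3) (h34 : s 3 ≤ s 4) (h4 : s 4 ≤ 7) (hn : 8 ≤ n) :
    (cycleGraph n).IsPackingCritical s ↔ ¬ ∃ m, (s 4 + 1) * m ≤ n ∧ n ≤ 8 * m := by
  constructor
  · rintro hc ⟨m, hm, hm'⟩
    obtain ⟨φ, hφ⟩ := exists_isPackingColoring_four h1 h2 h34 (by omega) h4 (by omega) hm hm'
    refine not_isPackingCritical_cycleGraph (by omega) hφ (fun ψ hψ hd => ?_) hc
    exact no_three_letter_word h1 h2 h3 0 (fun i hi => hψ _ (by omega))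
      (fun i d _ _ h0 _ => hd i d h0 (by omega))
  · intro hm
    refine isPackingCritical_cycleGraph_of_word (g := pathLetter) (k := 4) (by omega)
      (fun i hi => ?_) (fun i d h0 _ => pathLetter_spacing h1 h2 (by omega) h4 i d h0)
      (fun φ hφ => hm (hφ.exists_block_count h1 h2 h3 (by omega) (by omega)))
    simp only [pathLetter, Finset.mem_Icc]
    split_ifs <;> omega

end SimpleGraph

/-! ### The three lists of critical orders -/

open SimpleGraph in
theorem theorem4p1 (s : ℕ → ℕ) (hs : IsPackingSequence s) (n : ℕ) (hn : 3 ≤ n) :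
    ((s 1 = 1 ∧ s 2 = 2 ∧ s 3 = 4 ∧ s 4 = 4) →
      ((SimpleGraph.cycleGraph n).IsPackingCritical s ↔
        n ∈ ({3, 5, 6, 7, 9} : Set ℕ))) ∧
    ((s 1 = 1 ∧ s 2 = 2 ∧ 4 ≤ s 3 ∧ s 3 ≤ 5 ∧ s 4 = 5) →
      ((SimpleGraph.cycleGraph n).IsPackingCritical s ↔
        n ∈ ({3, 5, 6, 7, 9, 10, 11, 17} : Set ℕ))) ∧
    ((s 1 = 1 ∧ s 2 = 2 ∧ 4 ≤ s 3 ∧ s 3 ≤ 6 ∧ s 4 = 6) →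
      ((SimpleGraph.cycleGraph n).IsPackingCritical s ↔
        n ∈ ({3, 5, 6, 7, 9, 10, 11, 12, 13, 17, 18, 19, 20, 25, 26, 27, 33, 34, 41} : Set ℕ))) := by
  have h34 : s 3 ≤ s 4 := hs.2 3 4 (by norm_num) (by norm_num)
  have reduce : s 1 = 1 → s 2 = 2 → 4 ≤ s 3 → s 4 ≤ 7 → ∀ A : Set ℕ,
      3 ∈ A → 4 ∉ A → 5 ∈ A → 6 ∈ A → 7 ∈ A →
      (8 ≤ n → (n ∈ A ↔ ¬ ∃ m, (s 4 + 1) * m ≤ n ∧ n ≤ 8 * m)) →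
      ((cycleGraph n).IsPackingCritical s ↔ n ∈ A) := by
    intro h1 h2 h3 h4 A m3 m4 m5 m6 m7 hA
    rcases lt_or_ge n 8 with h8 | h8
    · by_cases hn4 : n = 4
      · subst hn4
        exact iff_of_false (not_isPackingCritical_cycleGraph_four h1 h2) m4
      · refine iff_of_true (isPackingCritical_cycleGraph_of_small h1 h2 h3 (by omega) h4 ?_) ?_
        · simp only [Set.mem_insert_iff, Set.mem_singleton_iff]
          omega
        · rcases (by omega : n = 3 ∨ n = 5 ∨ n = 6 ∨ n = 7) with rfl | rfl | rfl | rfl <;>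
            assumption
    · rw [isPackingCritical_cycleGraph_iff h1 h2 h3 h34 h4 h8, hA h8]
  refine ⟨?_, ?_, ?_⟩
  · rintro ⟨h1, h2, h3, h4⟩
    refine reduce h1 h2 (by omega) (by omega) _ (by simp) (by simp) (by simp) (by simp) (by simp)
      fun h8 => ?_
    simp only [Set.mem_insert_iff, Set.mem_singleton_iff, h4]
    refine ⟨fun h ⟨m, hm⟩ => by omega, fun h => ?_⟩
    by_contra hc
    -- The least `m` with `n ≤ 8 * m`; it makes the lower bound `(s 4 + 1) * m ≤ n` weakest.
    exact h ⟨(n + 7) / 8, by omega⟩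
  · rintro ⟨h1, h2, h3, h3', h4⟩
    refine reduce h1 h2 (by omega) (by omega) _ (by simp) (by simp) (by simp) (by simp) (by simp)
      fun h8 => ?_
    simp only [Set.mem_insert_iff, Set.mem_singleton_iff, h4]
    refine ⟨fun h ⟨m, hm⟩ => by omega, fun h => ?_⟩
    by_contra hc
    exact h ⟨(n + 7) / 8, by omega⟩
  · rintro ⟨h1, h2, h3, h3', h4⟩
    refine reduce h1 h2 (by omega) (by omega) _ (by simp) (by simp) (by simp) (by simp) (by simp)
      fun h8 => ?_
    simp only [Set.mem_insert_iff, Set.mem_singleton_iff, h4]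
    refine ⟨fun h ⟨m, hm⟩ => by omega, fun h => ?_⟩
    by_contra hc
    exact h ⟨(n + 7) / 8, by omega⟩
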